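/- A matrix $H\in\mathbb{C}^{8\times 8}$ is a $BH(4,8)$ matrix (quaternary complex Hadamard matrix of order $8$) if all its entries lie in $\{1,\mathbf i,-1,-\mathbf i\}$ and $HH^*=8I$. Matrices $H,K$ are equivalent, $H\sim K$, if $P_1D_1HD_2P_2=K$ for some permutation matrices $P_1,P_2$ and unitary diagonal matrices $D_1,D_2$. The fingerprint of an $8\times 8$ matrix $H$ is $$\Phi(H)=\bigl(\{(v,m): v \text{ is a modulus taken by some } d\times d \text{ minor of } H,\ m \text{ is the number of } d\times d \text{ minors of modulus } v\}\bigr)_{d=2,3,4}.$$ For unimodular $a,b,c,d,e\in\mathbb{C}$ let $$F_8^{(5)}(a,b,c,d,e)=\begin{bmatrix} 1&1&1&1&1&1&1&1\\ 1&a&b&c&-1&-a&-b&-c\\ 1&d&-1&-d&1&d&-1&-d\\ 1&e&-b&-\overline a c e&-1&-e&b&\overline a c e\\ 1&-1&1&-1&1&-1&1&-1\\ 1&-a&b&-c&-1&a&-b&c\\ 1&-d&-1&d&1&-d&-1&d\\ 1&-e&-b&\overline a c e&-1&e&b&-\overline a c e \end{bmatrix},$$ $$S_8^{(4)}(a,b,c,d)=\begin{bmatrix}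 1&1&1&1&1&1&1&1\\ 1&d&-d&-d&-1&cd&-cd&d\\ 1&a\overline d&b\overline d&-b\overline d&1&-1&-1&-a\overline d\\ 1&a&-b&b&-1&-cd&cd&-a\\ 1&-1&-b\overline d&b\overline d&1&c&-c&-1\\ 1&-d&b&-b&-1&d&d&-d\\ 1&-a\overline d&-1&-1&1&-c&c&a\overline d\\ 1&-a&d&d&-1&-d&-d&a \end{bmatrix},$$ $$D_{8B}^{(5)}(a,b,c,d,e)=\begin{bmatrix} 1&1&1&1&1&1&1&1\\ 1&a&-a&d&-d&-a&a&-1\\ 1&b&b\overline c e&-d&d&-b\overline c e&-b&-1\\ 1&c&-e&-1&-1&e&-c&1\\ 1&-c&e&-1&-1&-e&c&1\\ 1&-b&-b\overline c e&-d&d&b\overline c e&b&-1\\ 1&-a&a&d&-d&a&-a&-1\\ 1&-1&-1&1&1&-1&-1&1 \end{bmatrix}.$$ **Theorem.** There are exactly $15$ $BH(4,8)$ matrices up to equivalence, and the $15$ matrices listed below are $BH(4,8)$ matrices representing each equivalence class exactly once. 1. Five of them are equivalent to symmetric $BH(4,8)$ matrices, namely $F_8^{(5)}(1,1,1,1,1)$,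 $F_8^{(5)}(1,\mathbf i,\mathbf i,\mathbf i,\mathbf i)$, $F_8^{(5)}(\mathbf i,1,\mathbf i,1,\mathbf i)$, $F_8^{(5)}(1,1,\mathbf i,1,\mathbf i)$ and $S_8^{(4)}(1,1,\mathbf i,\mathbf i)$. 2. The other ten are $F_8^{(5)}(1,1,1,1,\mathbf i)$, $F_8^{(5)}(1,1,\mathbf i,\mathbf i,\mathbf i)$, $S_8^{(4)}(1,1,1,\mathbf i)$, $S_8^{(4)}(1,\mathbf i,1,\mathbf i)$, $D_{8B}^{(5)}(1,1,\mathbf i,\mathbf i,1)$ and their transposes; each of these ten is inequivalent to its transpose and to every symmetric matrix. 3. The fingerprint identifies the classes up to transposition: for all $BH(4,8)$ matrices $H$ and $K$, $\Phi(H)=\Phi(K)$ if and only if $H\sim K$ or $H\sim K^T$. -/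

import Mathlib

open Matrix

noncomputable section

/-- `IsButson q H` says that `H` is a Butson-type matrix `BH(q,n)`: its entries are `q`-th roots
of unity and `H Hᴴ = n I`. -/
def IsButson (q : ℕ) {n : ℕ} (H : Matrix (Fin n) (Fin n) ℂ) : Prop :=
  (∀ i j, H i j ^ q = 1) ∧ H * Hᴴ = (n : ℂ) • (1 : Matrix (Fin n) (Fin n) ℂ)

/-- Equivalence of (complex Hadamard) matrices: `P₁ D₁ H D₂ P₂ = K` for permutation matrices
`P₁, P₂` and unitary diagonal matrices `D₁, D₂`. -/
def HadEquiv {n : ℕ} (H K : Matrix (Fin n) (Fin n) ℂ) : Prop :=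
  ∃ (σ τ : Equiv.Perm (Fin n)) (d₁ d₂ : Fin n → ℂ),
    (∀ i, ‖d₁ i‖ = 1) ∧ (∀ j, ‖d₂ j‖ = 1) ∧
      σ.permMatrix ℂ * diagonal d₁ * H * diagonal d₂ * τ.permMatrix ℂ = K

/-- Entrywise form of the product that occurs in the definition of equivalence. -/
theorem permMatrix_diagonal_mul_apply {n : ℕ} (H : Matrix (Fin n) (Fin n) ℂ)
    (σ τ : Equiv.Perm (Fin n)) (d₁ d₂ : Fin n → ℂ) (i j : Fin n) :
    (σ.permMatrix ℂ * diagonal d₁ * H * diagonal d₂ * τ.permMatrix ℂ) i j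
      = d₁ (σ i) * H (σ i) (τ.symm j) * d₂ (τ.symm j) := by
  simp only [Equiv.Perm.permMatrix, Matrix.mul_assoc]
  rw [PEquiv.toMatrix_toPEquiv_mul, submatrix_apply, diagonal_mul, ← Matrix.mul_assoc,
    PEquiv.mul_toMatrix_toPEquiv, submatrix_apply, mul_diagonal]
  simp [mul_assoc]

theorem hadEquiv_iff {n : ℕ} (H K : Matrix (Fin n) (Fin n) ℂ) :
    HadEquiv H K ↔ ∃ (σ τ : Equiv.Perm (Fin n)) (d₁ d₂ : Fin n → ℂ),
      (∀ i, ‖d₁ i‖ = 1) ∧ (∀ j, ‖d₂ j‖ = 1) ∧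
        ∀ i j, K i j = d₁ i * H (σ i) (τ j) * d₂ j := by
  constructor
  · rintro ⟨σ, τ, d₁, d₂, h₁, h₂, rfl⟩
    refine ⟨σ, τ.symm, fun i => d₁ (σ i), fun j => d₂ (τ.symm j), fun i => h₁ _, fun j => h₂ _,
      fun i j => permMatrix_diagonal_mul_apply H σ τ d₁ d₂ i j⟩
  · rintro ⟨σ, τ, d₁, d₂, h₁, h₂, h⟩
    refine ⟨σ, τ.symm, fun i => d₁ (σ.symm i), fun j => d₂ (τ.symm j), fun i => h₁ _,
      fun j => h₂ _, ?_⟩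
    ext i j
    rw [permMatrix_diagonal_mul_apply, h]
    simp

theorem hadEquiv_refl {n : ℕ} (H : Matrix (Fin n) (Fin n) ℂ) : HadEquiv H H :=
  (hadEquiv_iff H H).2 ⟨1, 1, 1, 1, by simp, by simp, by simp⟩

theorem HadEquiv.symm {n : ℕ} {H K : Matrix (Fin n) (Fin n) ℂ} (h : HadEquiv H K) :
    HadEquiv K H := by
  obtain ⟨σ, τ, d₁, d₂, h₁, h₂, h⟩ := (hadEquiv_iff H K).1 h
  refine (hadEquiv_iff K H).2 ⟨σ.symm, τ.symm, fun i => (d₁ (σ.symm i))⁻¹,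
    fun j => (d₂ (τ.symm j))⁻¹, by simp [h₁], by simp [h₂], fun i j => ?_⟩
  have e₁ : d₁ (σ.symm i) ≠ 0 := norm_ne_zero_iff.1 (by simp [h₁])
  have e₂ : d₂ (τ.symm j) ≠ 0 := norm_ne_zero_iff.1 (by simp [h₂])
  rw [h]
  simp only [Equiv.apply_symm_apply]
  field_simp

theorem HadEquiv.trans {n : ℕ} {H K L : Matrix (Fin n) (Fin n) ℂ} (h : HadEquiv H K)
    (h' : HadEquiv K L) : HadEquiv H L := by
  obtain ⟨σ, τ, d₁, d₂, h₁, h₂, h⟩ := (hadEquiv_iff H K).1 h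
  obtain ⟨σ', τ', d₁', d₂', h₁', h₂', h'⟩ := (hadEquiv_iff K L).1 h'
  refine (hadEquiv_iff H L).2 ⟨σ'.trans σ, τ'.trans τ, fun i => d₁' i * d₁ (σ' i),
    fun j => d₂ (τ' j) * d₂' j, by simp [h₁, h₁'], by simp [h₂, h₂'], fun i j => ?_⟩
  rw [h', h]
  simp only [Equiv.trans_apply]
  ring

/-- Equivalence on the set of all `BH(q,n)` matrices. -/
def butsonSetoid (q n : ℕ) : Setoid {H : Matrix (Fin n) (Fin n) ℂ // IsButson q H} where
  r H K := HadEquiv H.1 K.1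
  iseqv := ⟨fun H => hadEquiv_refl H.1, fun h => h.symm, fun h h' => h.trans h'⟩

/-- The number of `d × d` minors of `H` of modulus `v`, a minor being given by a `d`-element set of
rows and a `d`-element set of columns, each listed increasingly. -/
def minorCount {n : ℕ} (H : Matrix (Fin n) (Fin n) ℂ) (d : ℕ) (v : ℝ) : ℕ :=
  Nat.card {p : (Fin d ↪o Fin n) × (Fin d ↪o Fin n) // ‖(H.submatrix p.1 p.2).det‖ = v}

/-- The fingerprint of `H`: the family, indexed by `d = 2, …, ⌊n/2⌋`, of the sets of pairs `(v, m)`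
where `v` is a modulus taken by the `d × d` minors of `H` and `m` is its multiplicity. -/
def fingerprint {n : ℕ} (H : Matrix (Fin n) (Fin n) ℂ) : Finset.Icc 2 (n / 2) → Set (ℝ × ℕ) :=
  fun d => {x | 0 < x.2 ∧ minorCount H d x.1 = x.2}

/-- The family `F₈⁽⁵⁾(a,b,c,d,e)`; `star` is complex conjugation. -/
def F8 (a b c d e : ℂ) : Matrix (Fin 8) (Fin 8) ℂ :=
  !![1,  1,  1,  1,  1,  1,  1,  1;
     1,  a,  b,  c, -1, -a, -b, -c;
     1,  d, -1, -d,  1,  d, -1, -d;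
     1,  e, -b, -(star a * c * e), -1, -e,  b, star a * c * e;
     1, -1,  1, -1,  1, -1,  1, -1;
     1, -a,  b, -c, -1,  a, -b,  c;
     1, -d, -1,  d,  1, -d, -1,  d;
     1, -e, -b, star a * c * e, -1,  e,  b, -(star a * c * e)]

/-- The family `S₈⁽⁴⁾(a,b,c,d)`. -/
def S8 (a b c d : ℂ) : Matrix (Fin 8) (Fin 8) ℂ :=
  !![1, 1, 1, 1, 1, 1, 1, 1;
     1, d, -d, -d, -1, c * d, -(c * d), d;
     1, a * star d, b * star d, -(b * star d), 1, -1, -1, -(a * star d);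
     1, a, -b, b, -1, -(c * d), c * d, -a;
     1, -1, -(b * star d), b * star d, 1, c, -c, -1;
     1, -d, b, -b, -1, d, d, -d;
     1, -(a * star d), -1, -1, 1, -c, c, a * star d;
     1, -a, d, d, -1, -d, -d, a]

/-- The family `D₈B⁽⁵⁾(a,b,c,d,e)`. -/
def D8B (a b c d e : ℂ) : Matrix (Fin 8) (Fin 8) ℂ :=
  !![1, 1, 1, 1, 1, 1, 1, 1;
     1, a, -a, d, -d, -a, a, -1;
     1, b, b * star c * e, -d, d, -(b * star c * e), -b, -1;
     1, c, -e, -1, -1, e, -c, 1;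
     1, -c, e, -1, -1, -e, c, 1;
     1, -b, -(b * star c * e), -d, d, b * star c * e, b, -1;
     1, -a, a, d, -d, a, -a, -1;
     1, -1, -1, 1, 1, -1, -1, 1]

/-- The representatives of the five classes that contain a symmetric matrix. -/
def symReps : Fin 5 → Matrix (Fin 8) (Fin 8) ℂ :=
  ![F8 1 1 1 1 1,
    F8 1 Complex.I Complex.I Complex.I Complex.I,
    F8 Complex.I 1 Complex.I 1 Complex.I,
    F8 1 1 Complex.I 1 Complex.I,
    S8 1 1 Complex.I Complex.I]

/-- The five matrices that, with their transposes, represent the other ten classes. -/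
def asymReps : Fin 5 → Matrix (Fin 8) (Fin 8) ℂ :=
  ![F8 1 1 1 1 Complex.I,
    F8 1 1 Complex.I Complex.I Complex.I,
    S8 1 1 1 Complex.I,
    S8 1 Complex.I 1 Complex.I,
    D8B 1 1 Complex.I Complex.I 1]

/-- The complete list of fifteen representatives. -/
def reps : Fin 5 ⊕ Fin 5 ⊕ Fin 5 → Matrix (Fin 8) (Fin 8) ℂ :=
  Sum.elim symReps (Sum.elim asymReps fun k => (asymReps k)ᵀ)

end

/-! The classification is an exhaustive search by rows. After scaling, the rows of a `BH(4,8)`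
matrix are exponent vectors modulo 4; the first row and the first column can be made zero. Each
level lists representatives of the partial matrices with `k` orthogonal rows. Every admissible extra
row of a representative yields a matrix that a certificate identifies, up to equivalence, with a
representative on the next level. The lists only have to cover all cases, so nothing needs to be
known about inequivalence within a level. Eight steps of induction, starting from one row of `H`,
end in the fifteen listed matrices (`covers_levels`, `ContainsRows.exists_extension`,
`ContainsRows.of_sortedColumns_eq`).

The classes are separated by two numbers: how many `4 × 4` minors vanish, and how many sets of four
rows carry exactly six vanishing minors. Both are invariant under equivalence. The first is also
invariant under transposition and takes ten values, which separate the classes up to transposition;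
as it is part of the fingerprint, the statement on fingerprints follows. The second separates each
of the ten asymmetric classes from its transpose, so none of them contains a symmetric matrix.

Vanishing is decided in finite rings: a Gaussian integer of modulus at most `r` is zero as soon as
it vanishes under `i ↦ r` in `ZMod (r ^ 2 + 1)`. Inner products use `r = 8`, determinants `r = 4! =
24`. -/

/-! ### The exhaustive search on encoded rows -/

/-- The entry in column `j` of a row with entries `0, 1, 2, 3`, encoded in base `4`. -/
def digit (r j : ℕ) : ℕ := Nat.mod (Nat.div r (Nat.pow 4 j)) 4

/-- `∑ j < n, f j`, in a form that the kernel evaluates quickly. -/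
noncomputable def sumBelow (f : ℕ → ℕ) (n : ℕ) : ℕ := Nat.rec 0 (fun j s => Nat.add (f j) s) n

/-- For encoded rows `v`, `w` this tests whether `∑ j, z ^ (v j - w j) = 0` in `ZMod 65`, where
`z = 8` is a square root of `-1`. -/
noncomputable def orth (v w : ℕ) : Bool :=
  Nat.beq (Nat.mod
    -- Since `z ^ 4 = 1`, the exponent `3 * w j` stands for `-w j`.
    (sumBelow (fun j => Nat.pow 8 (Nat.add (digit v j) (Nat.mul 3 (digit w j)))) 8) 65) 0

/-- A list of all encoded rows with first entry `0` that are orthogonal to the given rows. -/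
noncomputable def extensions : List ℕ → List ℕ
  -- Column `0` is the lowest base `4` digit and `16384 = 4 ^ 7`.
  | [] => (List.range 16384).map (Nat.mul 4)
  | w :: L => (extensions L).filter fun v => orth v w

/-- The sorted list of the columns of the matrix with the given rows, encoded in base `4`. -/
def sortedColumns (L : List (ℕ → ℕ)) : List ℕ :=
  ((List.range 8).map fun j => L.foldr (fun r a => Nat.add (Nat.mul 4 a) (r j)) 0).insertionSort
    (· ≤ ·)

/-- Row `i` of the matrix with encoded rows `M`, after normalizing row `q` and column `c`. -/
def normalizedRow (M : List ℕ) (q c i j : ℕ) : ℕ :=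
  Nat.mod (Nat.add
    (Nat.add (digit (M.getD i 0) j) (Nat.mul 3 (digit (M.getD q 0) j)))
    (Nat.add (Nat.mul 3 (digit (M.getD i 0) c)) (digit (M.getD q 0) c))) 4

/-- The row order encoded by a certificate `n`. -/
def certOrder (k n : ℕ) : List ℕ := (List.range k).map fun i => n / 8 ^ (i + 1) % 8

/-- The encoded rows of the target of a certificate `n`. -/
def certTarget (targets : List (List ℕ × List ℕ)) (k n : ℕ) : List ℕ :=
  (targets.getD (n / 8 ^ (k + 1)) ([], [])).1

/-- The sorted columns of the target of a certificate `n`, after the reordering and the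
normalization of its rows that `n` encodes. -/
def certColumns (targets : List (List ℕ × List ℕ)) (k n : ℕ) : List ℕ :=
  sortedColumns ((certOrder k n).map
    -- New rows are put in front, so the zero row of an extended list comes last; the target row
    -- matched with it is the one normalized to zero.
    (normalizedRow (certTarget targets k n) ((certOrder k n).getLastD 0) (n % 8)))

/-- A certificate is valid if its target has `k` rows and its row order is a permutation. -/
def certValid (targets : List (List ℕ × List ℕ)) (k n : ℕ) : Bool :=
  (certTarget targets k n).length == k && (List.range k).all fun i => (certOrder k n).contains i

/-- Each extension of the matrix with encoded rows `R.1` by one row is equivalent to the target of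
one of the certificates `R.2`. -/
noncomputable def covers (targets : List (List ℕ × List ℕ)) (R : List ℕ × List ℕ) : Bool :=
  R.2.all (certValid targets (R.1.length + 1)) &&
    (extensions R.1).all fun v => R.2.any fun n =>
      sortedColumns ((v :: R.1).map digit) == certColumns targets (R.1.length + 1) n

/-! ### Representatives and certificates for the search -/

/-- The encoded first row of a normalized matrix, with a list of certificates. The lists `level2`,
..., `level7` contain, in the same way, representatives of the matrices formed by two, ..., seven
orthogonal rows. A certificate is a number with digits `c, s₀, s₁, ...` in base `8`, followed by an
index `t`: after one more row has been added to the rows in the list, the resulting matrix has, up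
to a permutation of the columns, the rows `s₀, s₁, ...` of target number `t` in the next list,
normalized in the last of these rows and in column `c`. -/
def level1 : List (List ℕ × List ℕ) := [
  ([0], [64, 576, 1088, 577])]

/-- Representatives of the matrices formed by two orthogonal rows. -/
def level2 : List (List ℕ × List ℕ) := [
  ([680, 0], [1088, 5184, 9280, 5186, 13376, 5185]),
    ([1708, 0], [5128, 17472, 4232, 17024, 21568, 17026, 21120, 17474, 17476, 21122, 17028, 21570,
    5130, 17478, 4234, 17030, 21124, 17475, 21572, 17027]),
    ([5820, 0], [9224, 16912, 25664, 8328, 16914, 29760, 25670, 29312, 25666, 16913, 25668, 13320,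
    21008, 21010, 29200, 16916, 16918, 21012, 12424, 29201, 21009, 25667, 25669, 29313, 16917,
    16915, 25665, 29761])]

/-- Representatives of the matrices formed by three orthogonal rows. -/
def level3 : List (List ℕ × List ℕ) := [
    ([10280, 680, 0], [13376, 46144, 78912, 111680, 111685, 144448, 111683, 144000, 136832,
    111681, 46145]),
    ([10348, 680, 0], [177216, 209984, 209929, 111624, 242752, 275520, 308288, 111629, 242758,
    308293, 275526, 341056, 373824, 373830, 341061, 341063, 373831, 341062, 373829, 209989,
    209930]),
    ([10620, 680, 0], [406592, 439360, 144392, 308232, 308237, 472128, 308234, 504896, 504897,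
    308233, 439361]),
    ([27756, 680, 0], [439304, 46088, 537664, 570432, 570435, 603200, 599616, 143888, 373768,
    373774, 504840, 136720, 373775, 504841, 373773, 599619, 603203, 570439, 570434, 46089, 439305,
    570437, 603201, 570436, 599617, 570433, 599618, 570438, 603202, 373772, 463056, 635968,
    373771, 373770, 668736, 373769, 635969]),
    ([10360, 1708, 0], [701504, 734272, 733824, 364752, 340496, 366096, 767040, 799808, 832576,
    799360, 865344, 340500, 364756, 767047, 366100, 865351, 799367, 832583, 799815, 734279,
    733831]),
    ([24760, 1708, 0], [209424, 898112, 930880, 831627, 274960, 832520, 792080, 300560, 963648,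
    790741, 208976, 930432, 831624, 790736, 963200, 897664, 832523, 299216, 792085]),
    ([11736, 5820, 0], [996416, 1029184, 1025600, 561361, 827486, 569877, 860700, 1061952, 827934,
    562709, 820316, 569873, 827484, 860702, 561365, 827932, 562705, 820318, 1061959, 1025607,
    1029191]),
    ([20184, 5820, 0], [438800, 1029128, 590547, 1094720, 438352, 1028232, 591443, 635408,
    1028235, 1029131, 591441, 1028233, 493136, 1028237, 1094272, 1029133, 590545, 1029129,
    492240])]

/-- Representatives of the matrices formed by four orthogonal rows. -/
def level4 : List (List ℕ × List ℕ) := [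
  ([10880, 10280, 680, 0], [144448, 406592, 406597, 668736, 406595, 665152, 607808, 406593]),
    ([28356, 10280, 680, 0], [930880, 1193024, 902208, 1193026, 1189440, 1132096, 895040, 1189442,
    1132098, 1455168]),
    ([34952, 10280, 680, 0], [144392, 930824, 902152, 894984, 143496, 929928, 901256, 132744,
    919176, 18056, 919177, 901257, 929929, 894985, 902153, 930825]),
    ([34972, 10280, 680, 0], [406536, 1717312, 1979456, 1943621, 1713728, 1975872, 1656387,
    1918531, 1950789, 1914947]),
    ([35292, 10280, 680, 0], [668680, 1192968, 1192970, 2241600, 2503744, 2475072, 919120,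
    2765888, 919121, 2737216, 2503747, 2475075, 1192969, 1192973]),
    ([10948, 10348, 680, 0], [1716752, 1607888, 3028032, 2955456, 1716757, 1607893, 2955462,
    3028038, 3290176, 3217600, 3217605, 3290181, 3290183, 3217607, 3290182, 3217606]),
  ([28168, 10348, 680, 0], [1978896, 3552320, 1950224, 3523648, 3814464, 3813906]),
    ([35044, 10348, 680, 0], [1607832, 3814408, 1606936, 1712664, 3737800, 1655320, 3680456,
    3813512]),
  ([35128, 10348, 680, 0], [3027976, 3027080, 1974808, 4076608, 1917464, 4047936]),
    ([35292, 10348, 680, 0], [2955288, 3552264, 3551761, 4338752, 3737688, 4076552, 3680346,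
    4047886, 3523597, 3523090]),
  ([40072, 10348, 680, 0], [3290120, 3289228, 4600896, 4863040, 4572231, 4834375]),
  ([40164, 10348, 680, 0], [3217432, 5125184, 4600840, 4834318, 4572168, 4862990]),
    ([11220, 10620, 680, 0], [2241040, 4338192, 4338197, 2132176, 4338194, 5387328, 5387329,
    4338193]),
    ([27864, 10620, 680, 0], [2503184, 5649472, 2474512, 5649474, 5911616, 5911618, 6173760,
    5911622, 5911619, 6435904]),
    ([35292, 10620, 680, 0], [2132120, 5649416, 5649418, 6173704, 2131224, 5648520, 5648522,
    2765328, 1345745, 2736656, 1345744, 5648525, 5648521, 6173705, 5649421, 5649417]),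
    ([40092, 10620, 680, 0], [5387272, 5911560, 5911566, 5648464, 1192016, 6698048, 1192021,
    5648469, 6095640, 6960192, 6325528, 6931521, 5911565, 5911567]),
    ([28356, 27756, 680, 0], [2761240, 5124624, 5124630, 6697488, 2703896, 5124631, 6697489,
    5124629, 5124628, 2656408, 6588624, 5124627, 5124626, 2655512, 5124625, 6588625]),
  ([31176, 27756, 680, 0], [5910612, 7222336, 5911061, 7193667, 7484480, 7484035]),
  ([31440, 27756, 680, 0], [1187929, 7746624, 1131033, 7746628, 5571353, 5515353]),
  ([58680, 27756, 680, 0], [6588568, 2466336, 6959632, 2437664, 6930960, 6587672]),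
    ([58956, 27756, 680, 0], [6435344, 2655456, 7483923, 7483920, 2728480, 6326480, 2699808,
    6326481, 7483922, 7483927, 6435345, 7483921, 7483926, 7483925, 7483924, 2655904]),
    ([11988, 10360, 1708, 0], [4524120, 4596248, 4538456, 4465432, 8008768, 7946944, 8005184,
    7979648, 4596252, 4524124, 4465436, 4538460, 7979655, 8005191, 7946951, 8008775]),
  ([25560, 10360, 1708, 0], [4858392, 4767897, 4786266, 4723997]),
  ([36468, 10360, 1708, 0], [4465376, 4523616, 4563490, 4534370]),
  ([37368, 10360, 1708, 0], [8008712, 7979146, 8270912, 8241794]),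
  ([37768, 10360, 1708, 0], [7946776, 8230930, 8533056, 8241683]),
  ([40796, 10360, 1708, 0], [7979536, 7979090, 7964755, 8533007]),
    ([28188, 24760, 1708, 0], [4071960, 8229026, 8172578, 4014168, 3937566, 8229029, 3967134,
    8172581]),
  ([31512, 24760, 1708, 0], [3485797, 3511328, 3416801, 3442338]),
  ([40236, 24760, 1708, 0], [3547672, 3489880, 3413273, 3442841]),
    ([15204, 11736, 5820, 0], [7149094, 8492070, 7184932, 8495204, 7147750, 8495654, 7156260,
    8434724, 7184934, 8492068, 8495206, 7149092, 8495652, 7156262, 8434726, 7147748]),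
  ([20388, 11736, 5820, 0], [5902494, 5802142, 5784222, 7643417]),
  ([37860, 11736, 5820, 0], [7147806, 7217693, 7149597, 7160345]),
  ([30828, 20184, 5820, 0], [6951064, 6865944, 6882073, 6826073])]

/-- Representatives of the matrices formed by five orthogonal rows. -/
def level5 : List (List ℕ × List ℕ) := [
    ([34952, 10880, 10280, 680, 0], [1455168, 3552320, 3322944, 1426496, 3523648, 967744, 3523649,
    3322945, 3552321]),
    ([34972, 10880, 10280, 680, 0], [5649472, 7746624, 7459909, 5620800, 7717952, 5162051,
    7259203, 7517253, 7230531]),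
    ([35292, 10880, 10280, 680, 0], [9843776, 11940928, 11711552, 3523592, 14038080, 3523593,
    13808704, 11940931, 11711555]),
  ([34952, 28356, 10280, 680, 0], [3543248, 16135232, 3457232, 16135236, 18232384]),
  ([35292, 28356, 10280, 680, 0], [20329536, 15848456, 22426688]),
    ([58956, 28356, 10280, 680, 0], [18232328, 22426632, 18002952, 22426634, 22397960, 21939208,
    17945608, 22397962, 21939210]),
  ([35380, 34972, 10280, 680, 0], [5648912, 24523840, 26620992, 24294469, 26391621]),
  ([40456, 34972, 10280, 680, 0], [7746064, 26592264, 26333320]),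
    ([35700, 35292, 10280, 680, 0], [9843216, 20328976, 20328978, 18138136, 28718144, 18138137,
    28488768, 20328977, 20328981]),
  ([40116, 35292, 10280, 680, 0], [11940368, 30815296, 30786176]),
  ([41460, 35292, 10280, 680, 0], [14037520, 28718088, 30585864, 28717192, 30585867]),
  ([35128, 10948, 10348, 680, 0], [32912448, 26616344, 35009600, 26386968, 34780224]),
  ([40072, 10948, 10348, 680, 0], [37106752, 39203904, 41301056, 38974535, 41071687]),
  ([35292, 28168, 10348, 680, 0], [43398208, 45495360, 45260890]),
  ([41188, 28168, 10348, 680, 0], [26583136, 45495304, 26124384, 45265928, 47592512]),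
  ([41436, 35128, 10348, 680, 0], [35009040, 34772496, 49689664]),
    ([35700, 35292, 10348, 680, 0], [32330272, 43397648, 42220304, 46978080, 49689104, 46519330,
    49459734, 43168277, 41990933]),
  ([46308, 40072, 10348, 680, 0], [39203344, 39196180, 51786816]),
  ([46392, 40072, 10348, 680, 0], [41300496, 41063954, 53883968]),
  ([40524, 40164, 10348, 680, 0], [36524576, 51786256, 53654038, 51556880, 53883414]),
    ([40092, 11220, 10620, 680, 0], [19159192, 20320408, 55981120, 20320413, 19159197, 58078272,
    60175424, 57497664, 59946049]),
  ([35316, 27864, 10620, 680, 0], [19150176, 62272576, 21517024, 62272582, 64369728]),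
  ([40500, 27864, 10620, 680, 0], [62272523, 66466880, 65288869]),
  ([41844, 27864, 10620, 680, 0], [30810648, 21517080, 30581272, 21517085, 56907536]),
    ([59088, 27864, 10620, 680, 0], [30774304, 64369672, 30315552, 64369674, 65288981, 65288983,
    56907424, 65288982, 65288976]),
  ([40500, 40092, 10620, 680, 0], [55980560, 29890792, 68564032, 29890344, 68334657]),
  ([46536, 40092, 10620, 680, 0], [60174864, 68563976, 68333704]),
  ([40836, 31176, 27756, 680, 0], [70661184, 70660738, 70653573]),
  ([55776, 31176, 27756, 680, 0], [65284890, 70660626, 66462237, 70431253, 72758336]),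
  ([40392, 31440, 27756, 680, 0], [61186400, 61647393, 61199396]),
  ([37368, 11988, 10360, 1708, 0], [74855488, 76952640, 74070599]),
  ([46980, 37368, 10360, 1708, 0], [76952080, 74810465, 79049792]),
  ([46580, 37768, 10360, 1708, 0], [76718175, 76599450, 76714139])]

/-- Representatives of the matrices formed by six orthogonal rows. -/
def level6 : List (List ℕ × List ℕ) := [
  ([35360, 34952, 10880, 10280, 680, 0], [14038080, 30815296, 12203072, 30815297]),
  ([40500, 34952, 10880, 10280, 680, 0], [30585864, 47592512]),
  ([35380, 34972, 10880, 10280, 680, 0], [64369728, 81146944, 62534725, 79311941]),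
  ([40456, 34972, 10880, 10280, 680, 0], [80917512, 78852232]),
  ([35700, 35292, 10880, 10280, 680, 0], [47362576, 97924160, 47362577, 96089152]),
  ([40116, 35292, 10880, 10280, 680, 0], [114701376, 114471552]),
  ([41460, 35292, 10880, 10280, 680, 0], [97924104, 112866312, 97923208, 112866315]),
  ([40800, 34952, 28356, 10280, 680, 0], [131478592, 129571008]),
  ([58956, 34952, 28356, 10280, 680, 0], [47519768, 129570840, 46831640, 129570841]),
  ([35700, 35292, 28356, 10280, 680, 0], [129184272, 148255808]),
  ([58956, 35292, 28356, 10280, 680, 0], [148255752, 130717216]),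
  ([41140, 35380, 34972, 10280, 680, 0], [64365080, 54815512]),
  ([41416, 35380, 34972, 10280, 680, 0], [81142296, 165033024]),
  ([41460, 35700, 35292, 10280, 680, 0], [97919512, 88369944]),
  ([41820, 40116, 35292, 10280, 680, 0], [114696728, 181810240]),
  ([35728, 35128, 10948, 10348, 680, 0], [164995616, 198587456, 163160608, 196752448]),
  ([41436, 35128, 10948, 10348, 680, 0], [198587400, 193941640]),
  ([40480, 40072, 10948, 10348, 680, 0], [215364672, 232141888, 213529671, 230306887]),
  ([46308, 40072, 10948, 10348, 680, 0], [215364616, 210718856]),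
  ([46392, 40072, 10948, 10348, 680, 0], [232141832, 225661069]),
  ([35700, 35292, 28168, 10348, 680, 0], [248919104, 239455553]),
  ([41188, 35292, 28168, 10348, 680, 0], [248919048, 243476296]),
  ([59008, 41188, 28168, 10348, 680, 0], [164729896, 243477080, 161059880, 236137048]),
  ([41844, 41436, 35128, 10348, 680, 0], [193922152, 191915112]),
  ([46668, 46308, 40072, 10348, 680, 0], [210699368, 210527340]),
  ([46992, 46392, 40072, 10348, 680, 0], [225641581, 227304554]),
  ([40500, 40092, 11220, 10620, 680, 0], [174394160, 265696320, 172071728, 263861313]),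
  ([46260, 40092, 11220, 10620, 680, 0], [148182560, 174394272, 148182565, 174394720]),
  ([46536, 40092, 11220, 10620, 680, 0], [265696264, 263860360]),
  ([40800, 35316, 27864, 10620, 680, 0], [282473536, 282400963]),
  ([59088, 35316, 27864, 10620, 680, 0], [138820648, 282400795, 140716136, 282400796]),
  ([46260, 40500, 27864, 10620, 680, 0], [282472979, 299250752]),
  ([46536, 40500, 40092, 10620, 680, 0], [265691672, 256142104]),
  ([46884, 40836, 31176, 27756, 680, 0], [316027968, 315999299]),
  ([58956, 55776, 31176, 27756, 680, 0], [289794594, 315990567, 299213349, 314155553]),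
  ([40796, 37368, 11988, 10360, 1708, 0], [332805184, 330941056]),
  ([46980, 37368, 11988, 10360, 1708, 0], [332805128, 326525967]),
  ([47392, 46980, 37368, 10360, 1708, 0], [326508663, 330121781])]

/-- Representatives of the matrices formed by seven orthogonal rows. -/
def level7 : List (List ℕ × List ℕ) := [
  ([41120, 35360, 34952, 10880, 10280, 680, 0], [131478592]),
  ([41460, 35360, 34952, 10880, 10280, 680, 0], [777306584]),
  ([46620, 40500, 34952, 10880, 10280, 680, 0], [782814912]),
  ([41140, 35380, 34972, 10880, 10280, 680, 0], [1470949504]),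
  ([41416, 35380, 34972, 10880, 10280, 680, 0], [449869640]),
  ([41460, 35700, 35292, 10880, 10280, 680, 0], [393536768]),
  ([41820, 40116, 35292, 10880, 10280, 680, 0], [1549302472]),
  ([46560, 40800, 34952, 28356, 10280, 680, 0], [1841970754]),
  ([58956, 35700, 35292, 28356, 10280, 680, 0], [1836826706]),
  ([41824, 41416, 35380, 34972, 10280, 680, 0], [450083392]),
  ([46644, 41820, 40116, 35292, 10280, 680, 0], [1549522496]),
  ([41436, 35728, 35128, 10948, 10348, 680, 0], [912118530]),
  ([46308, 40480, 40072, 10948, 10348, 680, 0], [1199133446]),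
  ([46392, 40480, 40072, 10948, 10348, 680, 0], [1297212358]),
  ([41188, 35700, 35292, 28168, 10348, 680, 0], [1909707970]),
  ([46536, 40500, 40092, 11220, 10620, 680, 0], [259319041]),
  ([46920, 40800, 35316, 27864, 10620, 680, 0], [1666866757]),
  ([59088, 46260, 40500, 27864, 10620, 680, 0], [1666871849]),
  ([55776, 46884, 40836, 31176, 27756, 680, 0], [634222661]),
  ([46980, 40796, 37368, 11988, 10360, 1708, 0], [996100679])]

/-- The encoded rows of the fifteen representatives. -/
def repCodes : List (List ℕ) := [
  [0, 43520, 41120, 2720, 34952, 8840, 10280, 33320],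
  [0, 64080, 58596, 40500, 34952, 29400, 27756, 5820],
  [0, 60996, 41120, 20196, 34952, 26316, 10280, 50796],
  [0, 59968, 41120, 36388, 34952, 25288, 10280, 1708],
  [0, 19188, 26748, 41504, 46296, 54924, 56484, 15960],
  [0, 43520, 41120, 20196, 34952, 8840, 10280, 50796],
  [0, 59968, 58596, 36388, 34952, 25288, 27756, 1708],
  [0, 30452, 26748, 40480, 41176, 54924, 51364, 15960],
  [0, 30452, 26764, 40560, 41000, 55004, 51364, 15960],
  [0, 35680, 42480, 12964, 6796, 36312, 41800, 10280],
  [0, 59968, 41120, 19168, 34952, 25288, 10280, 49768],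
  [0, 64080, 41120, 40500, 34952, 29400, 10280, 5820],
  [0, 40500, 25020, 27420, 34952, 58596, 50796, 16020],
  [0, 40500, 26316, 27756, 34952, 58596, 50796, 16020],
  [0, 43840, 33976, 7860, 13980, 36376, 41440, 10280]]

theorem covers_levels :
    ([(level1, level2), (level2, level3), (level3, level4), (level4, level5), (level5, level6),
      (level6, level7), (level7, repCodes.map (·, []))].all
        fun p => p.1.all (covers p.2)) = true := by
  decide +kernel

/-! ### Powers of `i` and fourth roots of unity -/

theorem digit_eq (r j : ℕ) : digit r j = r / 4 ^ j % 4 := rfl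

theorem digit_lt (r j : ℕ) : digit r j < 4 := Nat.mod_lt _ (by norm_num)

theorem digit_zero (j : ℕ) : digit 0 j = 0 := by simp [digit_eq]

theorem sumBelow_eq (f : ℕ → ℕ) (n : ℕ) : sumBelow f n = ∑ j ∈ Finset.range n, f j := by
  induction n with
  | zero => rfl
  | succ n ih =>
    rw [Finset.sum_range_succ, ← ih, add_comm (sumBelow f n)]
    rfl

theorem I_pow_congr {a b : ℕ} (h : a % 4 = b % 4) : Complex.I ^ a = Complex.I ^ b := by
  rw [Complex.I_pow_eq_pow_mod a, h, ← Complex.I_pow_eq_pow_mod]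

theorem I_pow_pow_four (n : ℕ) : (Complex.I ^ n) ^ 4 = 1 := by
  rw [← pow_mul, mul_comm, pow_mul, Complex.I_pow_four, one_pow]

theorem norm_I_pow (n : ℕ) : ‖Complex.I ^ n‖ = 1 := by simp

theorem star_I_pow (n : ℕ) : star (Complex.I ^ n) = Complex.I ^ (3 * n) := by
  rw [pow_mul, star_pow]
  congr 1
  rw [pow_succ, Complex.I_sq]
  simp

theorem norm_of_pow_four {z : ℂ} (h : z ^ 4 = 1) : ‖z‖ = 1 :=
  (pow_eq_one_iff_of_nonneg (norm_nonneg z) four_ne_zero).1 (by rw [← norm_pow, h, norm_one])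

theorem mul_star_of_pow_four {z : ℂ} (h : z ^ 4 = 1) : z * star z = 1 := by
  have : star z = (starRingEnd ℂ) z := rfl
  rw [this, Complex.mul_conj, Complex.normSq_eq_norm_sq, norm_of_pow_four h]
  simp

theorem exists_I_pow {z : ℂ} (h : z ^ 4 = 1) : ∃ u < 4, z = Complex.I ^ u := by
  have h' : (z - 1) * (z + 1) * ((z - Complex.I) * (z + Complex.I)) = 0 := by
    linear_combination h - (z ^ 2 - 1) * Complex.I_sq
  rcases mul_eq_zero.1 h' with h' | h' <;> rcases mul_eq_zero.1 h' with h' | h'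
  · exact ⟨0, by norm_num, by linear_combination h'⟩
  · exact ⟨2, by norm_num, by linear_combination h' - Complex.I_sq⟩
  · exact ⟨1, by norm_num, by linear_combination h'⟩
  · exact ⟨3, by norm_num, by linear_combination h' - Complex.I * Complex.I_sq⟩

/-! ### Detecting zero by reduction of Gaussian integers -/

/-- Reduction of Gaussian integers modulo `r ^ 2 + 1`, with `r` as the image of `i`. -/
noncomputable def gaussianResidue (r : ℕ) : GaussianInt →+* ZMod (r ^ 2 + 1) :=
  Zsqrtd.lift ⟨(r : ZMod (r ^ 2 + 1)), by
    have h : ((r ^ 2 + 1 : ℕ) : ZMod (r ^ 2 + 1)) = 0 := ZMod.natCast_self _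
    push_cast at h ⊢
    linear_combination h⟩

/-- The Gaussian integer `i`. -/
def gaussianI : GaussianInt := ⟨0, 1⟩

theorem gaussianResidue_I (r : ℕ) : gaussianResidue r gaussianI = r := by
  simp [gaussianResidue, gaussianI, Zsqrtd.lift]

theorem toComplex_gaussianI : GaussianInt.toComplex gaussianI = Complex.I := by
  simp [GaussianInt.toComplex_def, gaussianI]

/-- Gaussian integers of small modulus are detected by their residues. -/
theorem gaussianResidue_eq_zero_iff {r : ℕ} {z : GaussianInt}
    (h : ‖GaussianInt.toComplex z‖ ≤ r) :
    gaussianResidue r z = 0 ↔ GaussianInt.toComplex z = 0 := by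
  rw [GaussianInt.toComplex_eq_zero]
  refine ⟨fun h0 => ?_, fun h0 => by rw [h0, map_zero]⟩
  have hn : (z.norm : ℝ) ≤ r ^ 2 := by
    rw [GaussianInt.intCast_real_norm, Complex.normSq_eq_norm_sq]
    gcongr
  have hn' : z.norm ≤ r ^ 2 := by exact_mod_cast hn
  -- The norm `z * star z` is divisible by `r ^ 2 + 1` but at most `r ^ 2`, hence zero.
  have hd : ((r ^ 2 + 1 : ℕ) : ℤ) ∣ z.norm := by
    rw [← ZMod.intCast_zmod_eq_zero_iff_dvd]
    have e : gaussianResidue r (z * star z) = 0 := by rw [map_mul, h0, zero_mul]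
    rwa [← Zsqrtd.norm_eq_mul_conj, map_intCast] at e
  refine GaussianInt.norm_eq_zero.1 (Int.eq_zero_of_dvd_of_nonneg_of_lt ?_ ?_ hd)
  · exact GaussianInt.norm_nonneg z
  · push_cast
    omega

/-- An inner product of two rows is a sum of eight units, so its modulus is at most `8` and its
residue modulo `8 ^ 2 + 1 = 65` decides whether it vanishes. -/
theorem orth_iff (v w : ℕ) :
    orth v w = true ↔ ∑ j : Fin 8, Complex.I ^ digit v j * star (Complex.I ^ digit w j) = 0 := by
  set z : GaussianInt := ∑ j : Fin 8, gaussianI ^ (digit v j + 3 * digit w j) with hz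
  have hc : GaussianInt.toComplex z
      = ∑ j : Fin 8, Complex.I ^ digit v j * star (Complex.I ^ digit w j) := by
    simp only [hz, map_sum, map_pow, toComplex_gaussianI, star_I_pow, ← pow_add]
  have hb : ‖GaussianInt.toComplex z‖ ≤ (8 : ℕ) := by
    rw [hc]
    refine (norm_sum_le _ _).trans ?_
    simp
  rw [← hc, ← gaussianResidue_eq_zero_iff hb]
  have hr : gaussianResidue 8 z
      = ((∑ j ∈ Finset.range 8, 8 ^ (digit v j + 3 * digit w j) : ℕ) : ZMod (8 ^ 2 + 1)) := by
    rw [Finset.sum_range]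
    simp only [hz, map_sum, map_pow, gaussianResidue_I, Nat.cast_sum, Nat.cast_pow]
  rw [hr, ZMod.natCast_eq_zero_iff, Nat.dvd_iff_mod_eq_zero]
  change Nat.beq _ 0 = true ↔ _
  rw [Nat.beq_eq, sumBelow_eq]
  rfl

theorem mem_extensions {v : ℕ} {L : List ℕ} :
    v ∈ extensions L ↔ (∃ u < 16384, 4 * u = v) ∧ ∀ w ∈ L, orth v w = true := by
  induction L with
  | nil => simp [extensions]
  | cons w L ih =>
    simp only [extensions, List.mem_filter, ih, List.forall_mem_cons]
    tauto

/-! ### Matching columns up to permutation -/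

/-- The column `j` of the matrix with the given rows, encoded in base `4`. -/
def columnCode (L : List (ℕ → ℕ)) (j : ℕ) : ℕ := L.foldr (fun r a => 4 * a + r j) 0

theorem columnCode_inj {L L' : List (ℕ → ℕ)} {j j' : ℕ} (hL : L.length = L'.length)
    (h : ∀ r ∈ L, r j < 4) (h' : ∀ r ∈ L', r j' < 4) (e : columnCode L j = columnCode L' j') :
    L.map (· j) = L'.map (· j') := by
  induction L generalizing L' with
  | nil =>
    cases L' with
    | nil => rfl
    | cons => simp at hL
  | cons r L ih =>
    cases L' with
    | nil => simp at hL
    | cons r' L' =>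
      simp only [List.forall_mem_cons] at h h'
      simp only [columnCode, List.foldr_cons] at e ih
      simp only [List.map_cons, List.cons.injEq]
      refine ⟨by omega, ih (by simpa using hL) h.2 h'.2 (by omega)⟩

/-- Both families have the same sorted list; sorting one and undoing the sorting of the other gives
the permutation. -/
theorem exists_perm_of_ofFn_perm {n : ℕ} {α : Type*} [LinearOrder α] {f g : Fin n → α}
    (h : (List.ofFn f).Perm (List.ofFn g)) : ∃ τ : Equiv.Perm (Fin n), ∀ j, f (τ j) = g j := by
  have hp : (List.ofFn (f ∘ Tuple.sort f)).Perm (List.ofFn (g ∘ Tuple.sort g)) :=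
    ((Equiv.Perm.ofFn_comp_perm _ f).trans h).trans (Equiv.Perm.ofFn_comp_perm _ g).symm
  have he := List.ofFn_injective (hp.eq_of_sortedLE
    (Tuple.monotone_sort f).sortedLE_ofFn (Tuple.monotone_sort g).sortedLE_ofFn)
  refine ⟨(Tuple.sort g).symm.trans (Tuple.sort f), fun j => ?_⟩
  have := congrFun he ((Tuple.sort g).symm j)
  simpa using this

theorem exists_perm_of_sortedColumns_eq {L L' : List (ℕ → ℕ)}
    (e : sortedColumns L = sortedColumns L') :
    ∃ τ : Equiv.Perm (Fin 8), ∀ j, columnCode L (τ j) = columnCode L' j := by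
  refine exists_perm_of_ofFn_perm (f := fun j => columnCode L j) (g := fun j => columnCode L' j) ?_
  have h : ∀ L : List (ℕ → ℕ), (sortedColumns L).Perm (List.ofFn fun j : Fin 8 => columnCode L j) :=
    fun L => (List.perm_insertionSort _ _).trans (List.Perm.of_eq (by
      rw [← List.map_coe_finRange_eq_range, List.map_map, List.ofFn_eq_map]
      rfl))
  exact ((h L).symm.trans (List.Perm.of_eq e)).trans (h L')

/-! ### Completeness of the search -/

/-- `ContainsRows L H` says that, up to equivalence over the fourth roots of unity, the matrix with
encoded rows `L` consists of rows of `H`. -/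
def ContainsRows (L : List ℕ) (H : Matrix (Fin 8) (Fin 8) ℂ) : Prop :=
  ∃ (ρ : ℕ → Fin 8) (τ : Equiv.Perm (Fin 8)) (d₁ : ℕ → ℂ) (d₂ : Fin 8 → ℂ),
    Set.InjOn ρ (Set.Iio L.length) ∧ (∀ i, d₁ i ^ 4 = 1) ∧ (∀ j, d₂ j ^ 4 = 1) ∧
      ∀ (i : ℕ) (hi : i < L.length) (j : Fin 8),
        d₁ i * H (ρ i) (τ j) * d₂ j = Complex.I ^ digit L[i] j

/-- The matrix with entries `i ^ a` where `a` runs through the entries of the encoded rows `M`. -/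
def expMatrix (M : List ℕ) : Matrix (Fin 8) (Fin 8) ℂ :=
  of fun i j => Complex.I ^ digit (M.getD i 0) j

theorem ne_zero_of_pow_four {z : ℂ} (h : z ^ 4 = 1) : z ≠ 0 := by
  rintro rfl
  norm_num at h

theorem IsButson.row_orthogonal {H : Matrix (Fin 8) (Fin 8) ℂ} (hH : IsButson 4 H) {i k : Fin 8}
    (h : i ≠ k) : ∑ j, H i j * star (H k j) = 0 := by
  have := congrFun (congrFun hH.2 i) k
  simpa [Matrix.mul_apply, h] using this

theorem containsRows_zero {H : Matrix (Fin 8) (Fin 8) ℂ} (hH : IsButson 4 H) :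
    ContainsRows [0] H := by
  refine ⟨0, 1, 1, fun j => (H 0 j)⁻¹, ?_, by simp, fun j => by simp [hH.1], ?_⟩
  · intro a ha b hb _
    simp at ha hb
    omega
  · intro i hi j
    obtain rfl : i = 0 := by simpa using hi
    simp [digit_zero, ne_zero_of_pow_four (hH.1 0 j)]

/-- A row of powers of `i` is encoded by a number. -/
theorem exists_encoding (u : ℕ → ℕ) (h : ∀ j, u j < 4) (h0 : u 0 = 0) :
    ∃ a < 16384, ∀ j < 8, digit (4 * a) j = u j := by
  refine ⟨u 1 + 4 * u 2 + 16 * u 3 + 64 * u 4 + 256 * u 5 + 1024 * u 6 + 4096 * u 7, ?_, ?_⟩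
  · have := h 1; have := h 2; have := h 3; have := h 4; have := h 5; have := h 6; have := h 7
    omega
  · have := h 1; have := h 2; have := h 3; have := h 4; have := h 5; have := h 6; have := h 7
    intro j hj
    rw [digit_eq]
    interval_cases j <;> norm_num <;> omega

/-- Some row of `H` is still unused. With the column data kept and the row rescaled to start with
`1`, it is a row of powers of `i` orthogonal to the earlier ones, so the enumeration finds it. -/
theorem ContainsRows.exists_extension {H : Matrix (Fin 8) (Fin 8) ℂ} (hH : IsButson 4 H)
    {L : List ℕ} (hL : ContainsRows L H) (hl : L.length < 8) :
    ∃ v ∈ extensions L, ContainsRows (v :: L) H := by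
  obtain ⟨ρ, τ, d₁, d₂, hρ, h₁, h₂, h⟩ := hL
  obtain ⟨r, hr⟩ : ∃ r, ∀ i < L.length, ρ i ≠ r := by
    by_contra! hc
    have : Finset.univ ⊆ (Finset.range L.length).image ρ := fun r _ => by
      obtain ⟨i, hi, e⟩ := hc r
      exact Finset.mem_image.2 ⟨i, Finset.mem_range.2 hi, e⟩
    have := (Finset.card_le_card this).trans Finset.card_image_le
    simp at this
    omega
  -- This scalar makes the first entry `1`, so that its exponent is `0` as `extensions` requires.
  set c : ℂ := (H r (τ 0) * d₂ 0)⁻¹ with hc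
  have hc4 : c ^ 4 = 1 := by simp [hc, mul_pow, hH.1, h₂]
  have hx : ∀ j : Fin 8, ∃ u < 4, c * H r (τ j) * d₂ j = Complex.I ^ u := fun j =>
    exists_I_pow (by simp [mul_pow, hH.1, h₂, hc4])
  choose u hu4 hu using hx
  have hu0 : u 0 = 0 := by
    have h1 : Complex.I ^ u 0 = 1 := by
      rw [← hu, mul_assoc, hc, inv_mul_cancel₀]
      exact mul_ne_zero (ne_zero_of_pow_four (hH.1 _ _)) (ne_zero_of_pow_four (h₂ 0))
    have h2 := hu4 0
    interval_cases u 0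
    · rfl
    · simp [Complex.ext_iff] at h1
    · norm_num [Complex.ext_iff] at h1
    · rw [pow_succ, Complex.I_sq] at h1
      simp [Complex.ext_iff] at h1
  obtain ⟨a, ha, hd⟩ := exists_encoding (fun j => if hj : j < 8 then u ⟨j, hj⟩ else 0)
    (fun j => by split_ifs <;> simp [hu4]) (by simpa using hu0)
  have hd' : ∀ j : Fin 8, digit (4 * a) j = u j := fun j => by simp [hd j j.2]
  refine ⟨4 * a, mem_extensions.2 ⟨⟨a, ha, rfl⟩, fun w hw => ?_⟩, fun i => Nat.casesOn i r ρ, τ,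
    fun i => Nat.casesOn i c d₁, d₂, ?_, ?_, h₂, ?_⟩
  · obtain ⟨i, hi, rfl⟩ := List.mem_iff_getElem.1 hw
    rw [orth_iff]
    -- The unimodular column factors cancel and the row factors are constant, leaving the inner
    -- product of two distinct rows of `H`.
    have key : ∀ j : Fin 8, Complex.I ^ digit (4 * a) j * star (Complex.I ^ digit L[i] j)
        = c * star (d₁ i) * (H r (τ j) * star (H (ρ i) (τ j))) := fun j => by
      rw [hd', ← hu, ← h i hi j]
      simp only [star_mul']
      linear_combination (c * star (d₁ i) * (H r (τ j) * star (H (ρ i) (τ j))))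
        * mul_star_of_pow_four (h₂ j)
    simp only [key]
    rw [← Finset.mul_sum, Equiv.sum_comp τ fun j => H r j * star (H (ρ i) j),
      hH.row_orthogonal (hr i hi).symm, mul_zero]
  · rintro (_ | i) hi (_ | j) hj e
    · rfl
    · exact absurd e.symm (hr j (by simpa using hj))
    · exact absurd e (hr i (by simpa using hi))
    · rw [hρ (by simpa using hi) (by simpa using hj) e]
  · rintro (_ | i)
    exacts [hc4, h₁ i]
  · rintro (_ | i) hi j
    · simpa [hd'] using hu j
    · simpa using h i (by simpa using hi) j

theorem normalizedRow_eq (M : List ℕ) (q c i j : ℕ) :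
    normalizedRow M q c i j = (digit (M.getD i 0) j + 3 * digit (M.getD q 0) j +
      (3 * digit (M.getD i 0) c + digit (M.getD q 0) c)) % 4 := rfl

/-- Equal sorted columns give a column permutation carrying row `i` of `L` to the normalized row
`s[i]` of `M`. Normalization only multiplies rows and columns by powers of `i`, so it is absorbed in
the scalars. -/
theorem ContainsRows.of_sortedColumns_eq {H : Matrix (Fin 8) (Fin 8) ℂ} {L M s : List ℕ} {q c : ℕ}
    (hL : ContainsRows L H) (hM : M.length = L.length) (hs : s.length = L.length)
    (hs' : ∀ i < L.length, i ∈ s)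
    (e : sortedColumns (L.map digit) = sortedColumns (s.map (normalizedRow M q c))) :
    ContainsRows M H := by
  obtain ⟨ρ, τ, d₁, d₂, hρ, h₁, h₂, h⟩ := hL
  obtain ⟨τ', hτ'⟩ := exists_perm_of_sortedColumns_eq e
  have hrow : ∀ (i : ℕ) (hi : i < L.length) (j : Fin 8),
      digit L[i] (τ' j) = normalizedRow M q c s[i] j := fun i hi j => by
    have := columnCode_inj (by simp [hs]) (by simp [digit_lt])
      (by simp [normalizedRow_eq, Nat.mod_lt]) (hτ' j)
    have := congrArg (fun l => l[i]?) this
    simpa [hi, hs] using this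
  -- Here `s.idxOf` inverts the row order, and the powers of `i` undo the normalization: all terms
  -- but the entry of `M` occur four times in the exponent.
  refine ⟨fun a => ρ (s.idxOf a), τ'.trans τ,
    fun a => d₁ (s.idxOf a) * Complex.I ^ (digit (M.getD a 0) c + 3 * digit (M.getD q 0) c),
    fun j => d₂ (τ' j) * Complex.I ^ digit (M.getD q 0) j, ?_, ?_, ?_, ?_⟩
  · intro a ha b hb hab
    simp only [Set.mem_Iio, hM] at ha hb
    have ha' := List.idxOf_lt_length_iff.2 (hs' a ha)
    have hb' := List.idxOf_lt_length_iff.2 (hs' b hb)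
    have := hρ (by simpa [hs] using ha') (by simpa [hs] using hb') hab
    rw [← List.getElem_idxOf ha', ← List.getElem_idxOf hb']
    simp only [this]
  · intro i
    rw [mul_pow, h₁, I_pow_pow_four, one_mul]
  · intro j
    rw [mul_pow, h₂, I_pow_pow_four, one_mul]
  · intro a ha j
    have ha' := List.idxOf_lt_length_iff.2 (hs' a (by omega))
    have ha'' : s.idxOf a < L.length := by omega
    have h3 := h (s.idxOf a) ha'' (τ' j)
    rw [hrow _ ha'', List.getElem_idxOf ha', normalizedRow_eq, ← Complex.I_pow_eq_pow_mod]
      at h3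
    have h4 : M.getD a 0 = M[a] := by simp [ha]
    calc _ = (d₁ (s.idxOf a) * H (ρ (s.idxOf a)) (τ (τ' j)) * d₂ (τ' j)) *
          (Complex.I ^ (digit (M.getD a 0) c + 3 * digit (M.getD q 0) c) *
            Complex.I ^ digit (M.getD q 0) j) := by
            simp only [Equiv.trans_apply]
            ring
      _ = _ := by
        rw [h3, ← h4, ← pow_add, ← pow_add]
        apply I_pow_congr
        omega

theorem ContainsRows.exists_target {H : Matrix (Fin 8) (Fin 8) ℂ} (hH : IsButson 4 H)
    {targets : List (List ℕ × List ℕ)} {R : List ℕ × List ℕ} (hR : covers targets R = true)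
    (hL : ContainsRows R.1 H) (hl : R.1.length < 8) :
    ∃ T ∈ targets, T.1.length = R.1.length + 1 ∧ ContainsRows T.1 H := by
  obtain ⟨v, hv, hc⟩ := hL.exists_extension hH hl
  simp only [covers, Bool.and_eq_true, List.all_eq_true, List.any_eq_true, beq_iff_eq] at hR
  obtain ⟨n, hn, e⟩ := hR.2 v hv
  have hval := hR.1 n hn
  simp only [certValid, Bool.and_eq_true, beq_iff_eq, List.all_eq_true, List.mem_range,
    List.contains_iff_mem] at hval
  have ht := ContainsRows.of_sortedColumns_eq hc (M := certTarget targets (R.1.length + 1) n)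
    (by simp [hval.1]) (by simp [certOrder]) (by simpa using hval.2) e
  have hlen := hval.1
  simp only [certTarget] at ht hlen
  -- An index out of range would give the empty default target, whose length is excluded by
  -- `certValid`.
  by_cases hm : n / 8 ^ (R.1.length + 1 + 1) < targets.length
  · rw [List.getD_eq_getElem _ _ hm] at ht hlen
    exact ⟨_, List.getElem_mem hm, hlen, ht⟩
  · rw [List.getD_eq_default _ _ (by omega)] at hlen
    simp at hlen

/-- Eight distinct rows of `H` are all of its rows, so `ρ` becomes a permutation. -/
theorem ContainsRows.hadEquiv {H : Matrix (Fin 8) (Fin 8) ℂ} {M : List ℕ} (hM : M.length = 8)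
    (h : ContainsRows M H) : HadEquiv H (expMatrix M) := by
  obtain ⟨ρ, τ, d₁, d₂, hρ, h₁, h₂, h⟩ := h
  have hinj : Function.Injective fun i : Fin 8 => ρ i := fun a b hab =>
    Fin.ext (hρ (by simp [hM]) (by simp [hM]) hab)
  refine (hadEquiv_iff _ _).2 ⟨Equiv.ofBijective _ (Finite.injective_iff_bijective.1 hinj), τ,
    fun i => d₁ i, d₂, fun i => norm_of_pow_four (h₁ i), fun j => norm_of_pow_four (h₂ j), ?_⟩
  intro i j
  have hi : (i : ℕ) < M.length := by omega
  simpa [expMatrix, hi] using (h i hi j).symm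

theorem IsButson.exists_hadEquiv_repCodes {H : Matrix (Fin 8) (Fin 8) ℂ} (hH : IsButson 4 H) :
    ∃ M ∈ repCodes, HadEquiv H (expMatrix M) := by
  have hc := covers_levels
  simp only [List.all_cons, List.all_nil, Bool.and_eq_true, Bool.and_true] at hc
  have step : ∀ {S T : List (List ℕ × List ℕ)} {k : ℕ}, S.all (covers T) = true → k < 8 →
      (∃ R ∈ S, R.1.length = k ∧ ContainsRows R.1 H) →
      ∃ R ∈ T, R.1.length = k + 1 ∧ ContainsRows R.1 H := by
    rintro S T k h hk ⟨R, hR, rfl, hc⟩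
    exact hc.exists_target hH (List.all_eq_true.1 h R hR) hk
  obtain ⟨h1, h2, h3, h4, h5, h6, h7⟩ := hc
  obtain ⟨R, hR, hl, h⟩ := step h7 (by norm_num) <| step h6 (by norm_num) <|
    step h5 (by norm_num) <| step h4 (by norm_num) <| step h3 (by norm_num) <|
    step h2 (by norm_num) <| step h1 (by norm_num)
      ⟨([0], [64, 576, 1088, 577]), by simp [level1], rfl, containsRows_zero hH⟩
  obtain ⟨M, hM, rfl⟩ := List.mem_map.1 hR
  exact ⟨M, hM, h.hadEquiv hl⟩

/-! ### The three families at powers of `i` -/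

/-- The encoded rows of the representatives `reps`. -/
def repCode : Fin 5 ⊕ Fin 5 ⊕ Fin 5 → List ℕ :=
  Sum.elim (fun k => repCodes.getD k [])
    (Sum.elim (fun k => repCodes.getD (k + 5) []) fun k => repCodes.getD (k + 10) [])

theorem exists_repCode_eq : ∀ M ∈ repCodes, ∃ k, repCode k = M := by decide +kernel

/-- Exponents of `i` in the entries of `F8 (i ^ a) (i ^ b) (i ^ c) (i ^ d) (i ^ e)`. -/
def F8Exp (a b c d e : ℕ) : Matrix (Fin 8) (Fin 8) ℕ :=
  !![0, 0, 0, 0, 0, 0, 0, 0;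
     0, a, b, c, 2, 2 + a, 2 + b, 2 + c;
     0, d, 2, 2 + d, 0, d, 2, 2 + d;
     0, e, 2 + b, 2 + (3 * a + c + e), 2, 2 + e, b, 3 * a + c + e;
     0, 2, 0, 2, 0, 2, 0, 2;
     0, 2 + a, b, 2 + c, 2, a, 2 + b, c;
     0, 2 + d, 2, d, 0, 2 + d, 2, d;
     0, 2 + e, 2 + b, 3 * a + c + e, 2, e, b, 2 + (3 * a + c + e)]

theorem neg_I_pow (n : ℕ) : -Complex.I ^ n = Complex.I ^ (2 + n) := by
  rw [pow_add, Complex.I_sq, neg_one_mul]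

theorem F8_I_pow (a b c d e : ℕ) :
    F8 (Complex.I ^ a) (Complex.I ^ b) (Complex.I ^ c) (Complex.I ^ d) (Complex.I ^ e)
      = (F8Exp a b c d e).map (Complex.I ^ ·) := by
  simp only [F8, F8Exp, star_I_pow, ← pow_add, neg_I_pow]
  -- The remaining entries `1` and `-1` become `i ^ 0` and `i ^ (2 + 0)`.
  rw [← pow_zero Complex.I, neg_I_pow]
  ext i j
  fin_cases i <;> fin_cases j <;> rfl

/-- Exponents of `i` in the entries of `S8 (i ^ a) (i ^ b) (i ^ c) (i ^ d)`. -/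
def S8Exp (a b c d : ℕ) : Matrix (Fin 8) (Fin 8) ℕ :=
  !![0, 0, 0, 0, 0, 0, 0, 0;
     0, d, 2 + d, 2 + d, 2, c + d, 2 + (c + d), d;
     0, a + 3 * d, b + 3 * d, 2 + (b + 3 * d), 0, 2, 2, 2 + (a + 3 * d);
     0, a, 2 + b, b, 2, 2 + (c + d), c + d, 2 + a;
     0, 2, 2 + (b + 3 * d), b + 3 * d, 0, c, 2 + c, 2;
     0, 2 + d, b, 2 + b, 2, d, d, 2 + d;
     0, 2 + (a + 3 * d), 2, 2, 0, 2 + c, c, a + 3 * d;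
     0, 2 + a, d, d, 2, 2 + d, 2 + d, a]

theorem S8_I_pow (a b c d : ℕ) :
    S8 (Complex.I ^ a) (Complex.I ^ b) (Complex.I ^ c) (Complex.I ^ d)
      = (S8Exp a b c d).map (Complex.I ^ ·) := by
  simp only [S8, S8Exp, star_I_pow, ← pow_add, neg_I_pow]
  rw [← pow_zero Complex.I, neg_I_pow]
  ext i j
  fin_cases i <;> fin_cases j <;> rfl

/-- Exponents of `i` in the entries of `D8B (i ^ a) (i ^ b) (i ^ c) (i ^ d) (i ^ e)`. -/
def D8BExp (a b c d e : ℕ) : Matrix (Fin 8) (Fin 8) ℕ :=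
  !![0, 0, 0, 0, 0, 0, 0, 0;
     0, a, 2 + a, d, 2 + d, 2 + a, a, 2;
     0, b, b + 3 * c + e, 2 + d, d, 2 + (b + 3 * c + e), 2 + b, 2;
     0, c, 2 + e, 2, 2, e, 2 + c, 0;
     0, 2 + c, e, 2, 2, 2 + e, c, 0;
     0, 2 + b, 2 + (b + 3 * c + e), 2 + d, d, b + 3 * c + e, b, 2;
     0, 2 + a, a, d, 2 + d, a, 2 + a, 2;
     0, 2, 2, 0, 0, 2, 2, 0]

theorem D8B_I_pow (a b c d e : ℕ) :
    D8B (Complex.I ^ a) (Complex.I ^ b) (Complex.I ^ c) (Complex.I ^ d) (Complex.I ^ e)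
      = (D8BExp a b c d e).map (Complex.I ^ ·) := by
  simp only [D8B, D8BExp, star_I_pow, ← pow_add, neg_I_pow]
  rw [← pow_zero Complex.I, neg_I_pow]
  ext i j
  fin_cases i <;> fin_cases j <;> rfl

theorem map_I_pow_eq_expMatrix {E : Matrix (Fin 8) (Fin 8) ℕ} {M : List ℕ}
    (h : ∀ i j, E i j % 4 = digit (M.getD i 0) j) : E.map (Complex.I ^ ·) = expMatrix M := by
  ext i j
  simp only [map_apply, expMatrix, of_apply]
  exact I_pow_congr (by rw [h, Nat.mod_eq_of_lt (digit_lt _ _)])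

theorem symReps_eq (k : Fin 5) : symReps k = expMatrix (repCode (Sum.inl k)) := by
  fin_cases k
  · exact (by simpa using F8_I_pow 0 0 0 0 0 : F8 1 1 1 1 1 = _).trans
      (map_I_pow_eq_expMatrix (by decide +kernel))
  · exact (by simpa using F8_I_pow 0 1 1 1 1 : F8 1 Complex.I Complex.I Complex.I Complex.I = _).trans
      (map_I_pow_eq_expMatrix (by decide +kernel))
  · exact (by simpa using F8_I_pow 1 0 1 0 1 : F8 Complex.I 1 Complex.I 1 Complex.I = _).trans
      (map_I_pow_eq_expMatrix (by decide +kernel))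
  · exact (by simpa using F8_I_pow 0 0 1 0 1 : F8 1 1 Complex.I 1 Complex.I = _).trans
      (map_I_pow_eq_expMatrix (by decide +kernel))
  · exact (by simpa using S8_I_pow 0 0 1 1 : S8 1 1 Complex.I Complex.I = _).trans
      (map_I_pow_eq_expMatrix (by decide +kernel))

theorem asymReps_eq (k : Fin 5) : asymReps k = expMatrix (repCode (Sum.inr (Sum.inl k))) := by
  fin_cases k
  · exact (by simpa using F8_I_pow 0 0 0 0 1 : F8 1 1 1 1 Complex.I = _).trans
      (map_I_pow_eq_expMatrix (by decide +kernel))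
  · exact (by simpa using F8_I_pow 0 0 1 1 1 : F8 1 1 Complex.I Complex.I Complex.I = _).trans
      (map_I_pow_eq_expMatrix (by decide +kernel))
  · exact (by simpa using S8_I_pow 0 0 0 1 : S8 1 1 1 Complex.I = _).trans
      (map_I_pow_eq_expMatrix (by decide +kernel))
  · exact (by simpa using S8_I_pow 0 1 0 1 : S8 1 Complex.I 1 Complex.I = _).trans
      (map_I_pow_eq_expMatrix (by decide +kernel))
  · exact (by simpa using D8B_I_pow 0 0 1 1 0 : D8B 1 1 Complex.I Complex.I 1 = _).trans
      (map_I_pow_eq_expMatrix (by decide +kernel))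

theorem expMatrix_transpose {M N : List ℕ}
    (h : ∀ i j : Fin 8, digit (M.getD i 0) j = digit (N.getD j 0) i) :
    (expMatrix M)ᵀ = expMatrix N := by
  ext i j
  simp only [expMatrix, transpose_apply, of_apply, h]

theorem reps_eq (k : Fin 5 ⊕ Fin 5 ⊕ Fin 5) : reps k = expMatrix (repCode k) := by
  rcases k with k | k | k
  · exact symReps_eq k
  · exact asymReps_eq k
  · refine (congrArg transpose (asymReps_eq k)).trans (expMatrix_transpose ?_)
    revert k
    decide +kernel

theorem isButson_expMatrix {M : List ℕ}
    (h : ∀ i j : Fin 8, i ≠ j → orth (M.getD i 0) (M.getD j 0) = true) :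
    IsButson 4 (expMatrix M) := by
  refine ⟨fun i j => I_pow_pow_four _, ?_⟩
  ext i j
  rw [Matrix.mul_apply]
  by_cases hij : i = j
  · subst hij
    have h1 : ∀ j, expMatrix M i j * (expMatrix M)ᴴ j i = 1 := fun j =>
      mul_star_of_pow_four (I_pow_pow_four _)
    simp only [h1]
    simp
  · have := (orth_iff _ _).1 (h i j hij)
    simpa [expMatrix, hij] using this

theorem isButson_reps (k : Fin 5 ⊕ Fin 5 ⊕ Fin 5) : IsButson 4 (reps k) := by
  rw [reps_eq]
  refine isButson_expMatrix ?_
  revert k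
  decide +kernel

theorem IsButson.exists_hadEquiv_reps {H : Matrix (Fin 8) (Fin 8) ℂ} (hH : IsButson 4 H) :
    ∃ k, HadEquiv H (reps k) := by
  obtain ⟨M, hM, h⟩ := hH.exists_hadEquiv_repCodes
  obtain ⟨k, rfl⟩ := exists_repCode_eq M hM
  exact ⟨k, reps_eq k ▸ h⟩

/-! ### Minors as invariants of equivalence -/

/-- The number of vanishing `d × d` minors of `H` in the rows listed by `e`. -/
noncomputable def vanishingMinors {n d : ℕ} (H : Matrix (Fin n) (Fin n) ℂ) (e : Fin d ↪o Fin n) : ℕ :=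
  Nat.card {f : Fin d ↪o Fin n // ‖(H.submatrix e f).det‖ = 0}

/-- The number of `d`-element sets of rows of `H` with exactly `t` vanishing `d × d` minors. -/
noncomputable def rowSetCount {n : ℕ} (H : Matrix (Fin n) (Fin n) ℂ) (d t : ℕ) : ℕ :=
  Nat.card {e : Fin d ↪o Fin n // vanishingMinors H e = t}

/-- A permutation of `Fin n` acts on the `d`-element subsets, listed increasingly. -/
theorem exists_orderEmbedding_equiv {n : ℕ} (d : ℕ) (σ : Equiv.Perm (Fin n)) :
    ∃ φ : (Fin d ↪o Fin n) ≃ (Fin d ↪o Fin n), ∀ e, ∃ π : Equiv.Perm (Fin d),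
      ∀ i, σ (e i) = φ e (π i) := by
  have h : ∀ e : Fin d ↪o Fin n, ∃ (e' : Fin d ↪o Fin n) (π : Equiv.Perm (Fin d)),
      ∀ i, σ (e i) = e' (π i) := fun e => by
    have hinj : Function.Injective fun i => σ (e i) := σ.injective.comp e.injective
    -- The image of the set under `σ` is listed increasingly by sorting; `π` records the sorting.
    refine ⟨OrderEmbedding.ofStrictMono ((fun i => σ (e i)) ∘ Tuple.sort fun i => σ (e i))
      ((Tuple.monotone_sort _).strictMono_of_injective (hinj.comp (Equiv.injective _))),
      (Tuple.sort fun i => σ (e i)).symm, fun i => by simp⟩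
  choose φ hφ using h
  have hinj : Function.Injective φ := fun e e' he => by
    obtain ⟨π, hπ⟩ := hφ e
    obtain ⟨π', hπ'⟩ := hφ e'
    -- An increasing listing is determined by its range, and `σ` acts injectively on sets.
    refine OrderEmbedding.range_inj.1 ?_
    have hr : ∀ (e : Fin d ↪o Fin n) (π : Equiv.Perm (Fin d)), (∀ i, σ (e i) = φ e (π i)) →
        σ '' Set.range e = Set.range (φ e) := fun e π h => by
      rw [← Set.range_comp, ← π.surjective.range_comp (φ e)]
      exact congrArg Set.range (funext h)
    exact σ.injective.image_injective (by rw [hr e π hπ, hr e' π' hπ', he])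
  exact ⟨Equiv.ofBijective φ (Finite.injective_iff_bijective.1 hinj), hφ⟩

theorem norm_det_submatrix_perm {d : ℕ} (A : Matrix (Fin d) (Fin d) ℂ)
    (π π' : Equiv.Perm (Fin d)) : ‖(A.submatrix π π').det‖ = ‖A.det‖ := by
  have h : A.submatrix π π' = (A.submatrix π id).submatrix id π' := rfl
  have hs : ∀ π : Equiv.Perm (Fin d), ‖((Equiv.Perm.sign π : ℤ) : ℂ)‖ = 1 := fun π => by
    rcases Int.units_eq_one_or (Equiv.Perm.sign π) with h | h <;> simp [h]
  rw [h, det_permute', det_permute, norm_mul, norm_mul, hs, hs, one_mul, one_mul]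

/-- The moduli of the minors of equivalent matrices correspond to each other. -/
theorem HadEquiv.exists_norm_det_eq {n : ℕ} {H K : Matrix (Fin n) (Fin n) ℂ} (h : HadEquiv H K)
    (d : ℕ) : ∃ φ ψ : (Fin d ↪o Fin n) ≃ (Fin d ↪o Fin n), ∀ e f : Fin d ↪o Fin n,
      ‖(K.submatrix e f).det‖ = ‖(H.submatrix (φ e) (ψ f)).det‖ := by
  obtain ⟨σ, τ, d₁, d₂, h₁, h₂, h⟩ := (hadEquiv_iff H K).1 h
  obtain ⟨φ, hφ⟩ := exists_orderEmbedding_equiv d σ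
  obtain ⟨ψ, hψ⟩ := exists_orderEmbedding_equiv d τ
  refine ⟨φ, ψ, fun e f => ?_⟩
  obtain ⟨π, hπ⟩ := hφ e
  obtain ⟨π', hπ'⟩ := hψ f
  -- The scalings leave the determinant as factors of modulus `1`; the permutations `π`, `π'` only
  -- affect its sign.
  have hK : K.submatrix e f = of fun i j => d₂ (f j) * (of fun i j => d₁ (e i) *
      (H.submatrix (φ e) (ψ f)).submatrix π π' i j) i j := by
    ext i j
    simp only [submatrix_apply, of_apply, h, hπ, hπ']
    ring
  rw [hK, det_mul_row, det_mul_column, norm_mul, norm_mul, norm_prod, norm_prod]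
  simp only [h₁, h₂, Finset.prod_const_one, one_mul]
  exact norm_det_submatrix_perm _ π π'

theorem HadEquiv.minorCount_eq {n : ℕ} {H K : Matrix (Fin n) (Fin n) ℂ} (h : HadEquiv H K)
    (d : ℕ) (v : ℝ) : minorCount H d v = minorCount K d v := by
  obtain ⟨φ, ψ, hφ⟩ := h.exists_norm_det_eq d
  exact (Nat.card_congr ((φ.prodCongr ψ).subtypeEquiv fun p => by rw [hφ]; rfl)).symm

theorem HadEquiv.rowSetCount_eq {n : ℕ} {H K : Matrix (Fin n) (Fin n) ℂ} (h : HadEquiv H K)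
    (d t : ℕ) : rowSetCount H d t = rowSetCount K d t := by
  obtain ⟨φ, ψ, hφ⟩ := h.exists_norm_det_eq d
  refine (Nat.card_congr (φ.subtypeEquiv fun e => ?_)).symm
  have : vanishingMinors K e = vanishingMinors H (φ e) :=
    Nat.card_congr (ψ.subtypeEquiv fun f => by rw [hφ])
  rw [this]

theorem minorCount_transpose {n : ℕ} (H : Matrix (Fin n) (Fin n) ℂ) (d : ℕ) (v : ℝ) :
    minorCount Hᵀ d v = minorCount H d v :=
  Nat.card_congr ((Equiv.prodComm _ _).subtypeEquiv fun p => by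
    rw [← det_transpose]
    rfl)

theorem HadEquiv.transpose {n : ℕ} {H K : Matrix (Fin n) (Fin n) ℂ} (h : HadEquiv H K) :
    HadEquiv Hᵀ Kᵀ := by
  obtain ⟨σ, τ, d₁, d₂, h₁, h₂, h⟩ := (hadEquiv_iff H K).1 h
  exact (hadEquiv_iff _ _).2 ⟨τ, σ, d₂, d₁, h₂, h₁, fun i j => by
    simp only [transpose_apply, h]
    ring⟩

theorem fingerprint_eq_of_minorCount_eq {n : ℕ} {H K : Matrix (Fin n) (Fin n) ℂ}
    (h : ∀ d v, minorCount H d v = minorCount K d v) : fingerprint H = fingerprint K := by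
  funext d
  simp only [fingerprint, h]

theorem minorCount_eq_of_fingerprint_eq {n : ℕ} {H K : Matrix (Fin n) (Fin n) ℂ}
    (h : fingerprint H = fingerprint K) {d : ℕ} (hd : d ∈ Finset.Icc 2 (n / 2)) (v : ℝ) :
    minorCount H d v = minorCount K d v := by
  have h' : ∀ m, 0 < m ∧ minorCount H d v = m ↔ 0 < m ∧ minorCount K d v = m := fun m =>
    Set.ext_iff.1 (congrFun h ⟨d, hd⟩) (v, m)
  -- The fingerprint records only positive multiplicities, so a value that is not attained is
  -- treated separately.
  rcases Nat.eq_zero_or_pos (minorCount H d v) with h0 | h0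
  · rcases Nat.eq_zero_or_pos (minorCount K d v) with h1 | h1
    · rw [h0, h1]
    · exact ((h' _).2 ⟨h1, rfl⟩).2
  · exact ((h' _).1 ⟨h0, rfl⟩).2.symm

theorem minorCount_zero_eq_sum {n : ℕ} (H : Matrix (Fin n) (Fin n) ℂ) (d : ℕ) :
    minorCount H d 0 = ∑ e : Fin d ↪o Fin n, vanishingMinors H e := by
  have h : {p : (Fin d ↪o Fin n) × (Fin d ↪o Fin n) // ‖(H.submatrix p.1 p.2).det‖ = 0} ≃
      Σ e : Fin d ↪o Fin n, {f : Fin d ↪o Fin n // ‖(H.submatrix e f).det‖ = 0} :=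
    { toFun p := ⟨p.1.1, p.1.2, p.2⟩
      invFun q := ⟨(q.1, q.2.1), q.2.2⟩
      left_inv _ := rfl
      right_inv _ := rfl }
  rw [minorCount, Nat.card_congr h, Nat.card_sigma]
  rfl

/-! ### Computing the vanishing `4 × 4` minors -/

/-- All increasing quadruples of numbers below `8`. -/
def quadruples : List (ℕ × ℕ × ℕ × ℕ) :=
  (List.range 8).flatMap fun a => ((List.range 8).filter (Nat.blt a)).flatMap fun b =>
    ((List.range 8).filter (Nat.blt b)).flatMap fun c =>
      ((List.range 8).filter (Nat.blt c)).map fun d => (a, b, c, d)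

theorem mem_quadruples {a b c d : ℕ} :
    (a, b, c, d) ∈ quadruples ↔ a < b ∧ b < c ∧ c < d ∧ d < 8 := by
  simp only [quadruples, List.mem_flatMap, List.mem_map, List.mem_filter, List.mem_range,
    Nat.blt_eq, Prod.mk.injEq]
  constructor
  · rintro ⟨a, ha, b, ⟨hb, hab⟩, c, ⟨hc, hbc⟩, d, ⟨hd, hcd⟩, rfl, rfl, rfl, rfl⟩
    exact ⟨hab, hbc, hcd, hd⟩
  · rintro ⟨hab, hbc, hcd, hd⟩
    exact ⟨a, by omega, b, ⟨by omega, hab⟩, c, ⟨by omega, hbc⟩, d, ⟨hd, hcd⟩, rfl, rfl, rfl, rfl⟩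

theorem nodup_quadruples : quadruples.Nodup := by decide +kernel

/-- The quadruple of rows or columns listed by an order embedding. -/
def embQuadruple (e : Fin 4 ↪o Fin 8) : ℕ × ℕ × ℕ × ℕ := (e 0, e 1, e 2, e 3)

theorem embQuadruple_injective : Function.Injective embQuadruple := fun e f h => by
  simp only [embQuadruple, Prod.mk.injEq, Fin.val_inj] at h
  ext i
  fin_cases i <;> simp [h]

theorem image_embQuadruple : Finset.univ.image embQuadruple = quadruples.toFinset := by
  ext ⟨a, b, c, d⟩
  simp only [Finset.mem_image, Finset.mem_univ, true_and, List.mem_toFinset, mem_quadruples]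
  constructor
  · rintro ⟨e, h⟩
    simp only [embQuadruple, Prod.mk.injEq] at h
    obtain ⟨rfl, rfl, rfl, rfl⟩ := h
    exact ⟨e.strictMono (by decide), e.strictMono (by decide), e.strictMono (by decide),
      (e 3).2⟩
  · rintro ⟨hab, hbc, hcd, hd⟩
    refine ⟨OrderEmbedding.ofStrictMono
      ![⟨a, by omega⟩, ⟨b, by omega⟩, ⟨c, by omega⟩, ⟨d, hd⟩] ?_, rfl⟩
    rw [Fin.strictMono_iff_lt_succ]
    intro i
    fin_cases i
    exacts [hab, hbc, hcd]

theorem sum_embQuadruple (g : ℕ × ℕ × ℕ × ℕ → ℕ) :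
    ∑ e, g (embQuadruple e) = (quadruples.map g).sum := by
  rw [← List.sum_toFinset _ nodup_quadruples, ← image_embQuadruple,
    Finset.sum_image embQuadruple_injective.injOn]

theorem card_embQuadruple (p : ℕ × ℕ × ℕ × ℕ → Bool) :
    Nat.card {e // p (embQuadruple e) = true} = quadruples.countP p := by
  have h := sum_embQuadruple fun x => if p x = true then 1 else 0
  rw [Nat.card_eq_fintype_card, Fintype.card_subtype, Finset.card_filter, h]
  induction quadruples with
  | nil => rfl
  | cons x l ih =>
    rw [List.map_cons, List.sum_cons, ih, List.countP_cons, add_comm]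

/-- The entries of the matrix with encoded rows `M` modulo `577`, where `24` is a square root
of `-1`. -/
def residue (M : List ℕ) (i j : ℕ) : ℕ := Nat.pow 24 (digit (M.getD i 0) j)

/-- A `2 × 2` minor modulo `577`. -/
def minorTwo (f : ℕ → ℕ → ℕ) (a b c d : ℕ) : ℕ :=
  Nat.add (Nat.mul (f a c) (f b d)) (Nat.mul 576 (Nat.mul (f a d) (f b c)))

/-- A `4 × 4` minor modulo `577`, by Laplace expansion along two pairs of rows. -/
def minorFour (f : ℕ → ℕ → ℕ) : ℕ × ℕ × ℕ × ℕ → ℕ × ℕ × ℕ × ℕ → ℕ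
  | (a, b, c, d), (p, q, r, s) =>
    Nat.add
      (Nat.add
        (Nat.add (Nat.mul (minorTwo f a b p q) (minorTwo f c d r s))
          (Nat.mul (minorTwo f a b p s) (minorTwo f c d q r)))
        (Nat.add (Nat.mul (minorTwo f a b q r) (minorTwo f c d p s))
          (Nat.mul (minorTwo f a b r s) (minorTwo f c d p q))))
      (Nat.mul 576
        (Nat.add (Nat.mul (minorTwo f a b p r) (minorTwo f c d q s))
          (Nat.mul (minorTwo f a b q s) (minorTwo f c d p r))))

/-- For each set of four rows, the number of vanishing `4 × 4` minors of the matrix with encoded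
rows `M`. -/
def vanishingCounts (M : List ℕ) : List ℕ :=
  quadruples.map fun x => quadruples.countP fun y =>
    Nat.beq (Nat.mod (minorFour (residue M) x y) 577) 0

/-- The factor `576` plays the role of `-1`, so the Laplace expansion needs no subtraction in `ℕ`.
-/
theorem det_four_mod (f : ℕ → ℕ → ℕ) (x y : Fin 4 → ℕ) :
    (of fun i j => (f (x i) (y j) : ZMod 577)).det
      = (minorFour f (x 0, x 1, x 2, x 3) (y 0, y 1, y 2, y 3) : ℕ) := by
  have h : (576 : ZMod 577) = -1 := by decide
  simp only [minorFour, minorTwo, Nat.add_eq, Nat.mul_eq]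
  push_cast
  rw [h, det_succ_row_zero]
  simp [det_succ_row_zero, Fin.sum_univ_succ, Fin.succAbove]
  ring

/-- The determinant is a Gaussian integer and a signed sum of `4! = 24` units, so its residue modulo
`24 ^ 2 + 1 = 577` detects zero. -/
theorem norm_det_expMatrix_eq_zero_iff (M : List ℕ) (e f : Fin 4 ↪o Fin 8) :
    ‖((expMatrix M).submatrix e f).det‖ = 0 ↔
      Nat.beq (Nat.mod (minorFour (residue M) (embQuadruple e) (embQuadruple f)) 577) 0 = true := by
  set A : Matrix (Fin 4) (Fin 4) GaussianInt :=
    of fun i j => gaussianI ^ digit (M.getD (e i) 0) (f j) with hA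
  have hc : ((expMatrix M).submatrix e f).det = GaussianInt.toComplex A.det := by
    rw [RingHom.map_det]
    congr 1
    ext i j
    simp [hA, expMatrix, toComplex_gaussianI]
  have hb : ‖GaussianInt.toComplex A.det‖ ≤ (24 : ℕ) := by
    rw [← hc]
    have := det_le (A := (expMatrix M).submatrix e f) (abv := NormedField.toAbsoluteValue ℂ)
      (x := 1) fun i j => (norm_I_pow _).le
    rw [Fintype.card_fin, one_pow] at this
    refine le_trans this ?_
    norm_num [Nat.factorial]
  have hr : gaussianResidue 24 A.det
      = ((minorFour (residue M) (embQuadruple e) (embQuadruple f) : ℕ) : ZMod 577) := by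
    refine Eq.trans ?_ (det_four_mod (residue M) (fun i => e i) fun j => f j)
    rw [RingHom.map_det]
    congr 1
    ext i j
    simp only [hA, RingHom.mapMatrix_apply, map_apply, of_apply, map_pow, gaussianResidue_I]
    exact (Nat.cast_pow 24 _).symm
  rw [hc, norm_eq_zero, ← gaussianResidue_eq_zero_iff hb, hr, Nat.beq_eq,
    ZMod.natCast_eq_zero_iff, Nat.dvd_iff_mod_eq_zero]
  rfl

theorem vanishingMinors_expMatrix (M : List ℕ) (e : Fin 4 ↪o Fin 8) :
    vanishingMinors (expMatrix M) e = quadruples.countP fun y =>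
      Nat.beq (Nat.mod (minorFour (residue M) (embQuadruple e) y) 577) 0 := by
  rw [← card_embQuadruple]
  exact Nat.card_congr (Equiv.subtypeEquivRight fun f => norm_det_expMatrix_eq_zero_iff M e f)

theorem minorCount_expMatrix (M : List ℕ) :
    minorCount (expMatrix M) 4 0 = (vanishingCounts M).sum := by
  rw [minorCount_zero_eq_sum, vanishingCounts, ← sum_embQuadruple]
  simp only [vanishingMinors_expMatrix]

theorem rowSetCount_expMatrix (M : List ℕ) (t : ℕ) :
    rowSetCount (expMatrix M) 4 t = (vanishingCounts M).countP (· == t) := by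
  rw [vanishingCounts, List.countP_map, ← card_embQuadruple]
  exact Nat.card_congr (Equiv.subtypeEquivRight fun e => by
    simp [vanishingMinors_expMatrix])

/-! ### Separating the classes; fingerprints -/

/-- The number of vanishing `4 × 4` minors, and the number of sets of four rows with exactly six
of them, for each of the representatives. -/
def invariantTable : Fin 5 ⊕ Fin 5 ⊕ Fin 5 → ℕ × ℕ :=
  Sum.elim ![(1428, 0), (852, 0), (1204, 0), (596, 40), (504, 0)]
    (Sum.elim ![(948, 16), (836, 48), (360, 0), (652, 0), (348, 0)]
      ![(948, 32), (836, 16), (360, 12), (652, 16), (348, 32)])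

theorem invariants_repCode : ∀ k, ((vanishingCounts (repCode k)).sum,
    (vanishingCounts (repCode k)).countP (· == 6)) = invariantTable k := by
  decide +kernel

theorem minorCount_reps (k : Fin 5 ⊕ Fin 5 ⊕ Fin 5) :
    minorCount (reps k) 4 0 = (invariantTable k).1 := by
  rw [reps_eq, minorCount_expMatrix, ← invariants_repCode]

theorem rowSetCount_reps (k : Fin 5 ⊕ Fin 5 ⊕ Fin 5) :
    rowSetCount (reps k) 4 6 = (invariantTable k).2 := by
  rw [reps_eq, rowSetCount_expMatrix, ← invariants_repCode]

/-- The first number separates up to transposition. The second is defined by rows alone, hence may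
change under transposition, and separates each asymmetric representative from its transpose. -/
theorem invariantTable_injective : Function.Injective invariantTable := by decide +kernel

theorem eq_of_hadEquiv_reps {k l : Fin 5 ⊕ Fin 5 ⊕ Fin 5} (h : HadEquiv (reps k) (reps l)) :
    k = l := by
  apply invariantTable_injective
  ext
  · rw [← minorCount_reps, ← minorCount_reps, h.minorCount_eq]
  · rw [← rowSetCount_reps, ← rowSetCount_reps, h.rowSetCount_eq]

theorem IsButson.existsUnique_hadEquiv_reps {H : Matrix (Fin 8) (Fin 8) ℂ} (hH : IsButson 4 H) :
    ∃! k, HadEquiv H (reps k) := by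
  obtain ⟨k, hk⟩ := hH.exists_hadEquiv_reps
  exact ⟨k, hk, fun l hl => eq_of_hadEquiv_reps (hl.symm.trans hk)⟩

theorem card_quotient_butsonSetoid : Nat.card (Quotient (butsonSetoid 4 8)) = 15 := by
  have hb : Function.Bijective fun k =>
      (Quotient.mk (butsonSetoid 4 8) ⟨reps k, isButson_reps k⟩) := by
    refine ⟨fun k l h => eq_of_hadEquiv_reps (Quotient.exact h : HadEquiv (reps k) (reps l)),
      fun q => ?_⟩
    obtain ⟨⟨H, hH⟩, rfl⟩ := Quotient.exists_rep q
    obtain ⟨k, hk⟩ := hH.exists_hadEquiv_reps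
    exact ⟨k, Quotient.sound (s := butsonSetoid 4 8) hk.symm⟩
  rw [← Nat.card_eq_of_bijective _ hb]
  simp

/-- Representatives with the same number of vanishing `4 × 4` minors agree up to transposition. -/
theorem eq_or_transpose_of_invariantTable_eq : ∀ k l : Fin 5 ⊕ Fin 5 ⊕ Fin 5,
    (invariantTable k).1 = (invariantTable l).1 →
      k = l ∨ ∃ a, (k = Sum.inr (Sum.inl a) ∧ l = Sum.inr (Sum.inr a)) ∨
        (k = Sum.inr (Sum.inr a) ∧ l = Sum.inr (Sum.inl a)) := by
  decide +kernel

/-- Both matrices can be replaced by their representatives, for which the table settles the claim.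
This is the only information taken from the fingerprint. -/
theorem hadEquiv_or_transpose_of_minorCount_eq {H K : Matrix (Fin 8) (Fin 8) ℂ}
    (hH : IsButson 4 H) (hK : IsButson 4 K) (h : minorCount H 4 0 = minorCount K 4 0) :
    HadEquiv H K ∨ HadEquiv H Kᵀ := by
  obtain ⟨k, hk⟩ := hH.exists_hadEquiv_reps
  obtain ⟨l, hl⟩ := hK.exists_hadEquiv_reps
  rw [hk.minorCount_eq, hl.minorCount_eq, minorCount_reps, minorCount_reps] at h
  rcases eq_or_transpose_of_invariantTable_eq k l h with rfl | ⟨a, ⟨rfl, rfl⟩ | ⟨rfl, rfl⟩⟩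
  · exact Or.inl (hk.trans hl.symm)
  · exact Or.inr (hk.trans hl.symm.transpose)
  · exact Or.inr (hk.trans hl.symm.transpose)

theorem fingerprint_eq_iff {H K : Matrix (Fin 8) (Fin 8) ℂ} (hH : IsButson 4 H)
    (hK : IsButson 4 K) : fingerprint H = fingerprint K ↔ HadEquiv H K ∨ HadEquiv H Kᵀ := by
  constructor
  · exact fun h => hadEquiv_or_transpose_of_minorCount_eq hH hK
      (minorCount_eq_of_fingerprint_eq h (by decide) 0)
  · rintro (h | h)
    · exact fingerprint_eq_of_minorCount_eq h.minorCount_eq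
    · exact fingerprint_eq_of_minorCount_eq fun d v =>
        (h.minorCount_eq d v).trans (minorCount_transpose K d v)

theorem not_hadEquiv_transpose_asymReps (k : Fin 5) :
    ¬ HadEquiv (asymReps k) (asymReps k)ᵀ := fun h => by
  have : (Sum.inr (Sum.inl k) : Fin 5 ⊕ Fin 5 ⊕ Fin 5) = Sum.inr (Sum.inr k) :=
    eq_of_hadEquiv_reps h
  simp at this

/-! ### Symmetric matrices and the main theorem -/

/-- The encoded rows of symmetric matrices equivalent to the matrices `symReps`. -/
def symCode : Fin 5 → List ℕ :=
  ![repCode (Sum.inl 0), repCode (Sum.inl 1), repCode (Sum.inl 2), repCode (Sum.inl 3),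
    [0, 25020, 27420, 34952, 40500, 55200, 62760, 16020]]

theorem minorCount_symCode (k : Fin 5) :
    minorCount (expMatrix (symCode k)) 4 0 = (invariantTable (Sum.inl k)).1 := by
  rw [minorCount_expMatrix]
  revert k
  decide +kernel

/-- No explicit equivalence is needed: the candidate has the right number of vanishing minors, so it
or its transpose is equivalent to the representative, and these two coincide. -/
theorem exists_isSymm_hadEquiv_symReps (k : Fin 5) : ∃ S : Matrix (Fin 8) (Fin 8) ℂ,
    IsButson 4 S ∧ S.IsSymm ∧ HadEquiv (symReps k) S := by
  have hS : (expMatrix (symCode k)).IsSymm := expMatrix_transpose (by revert k; decide +kernel)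
  have hB : IsButson 4 (expMatrix (symCode k)) :=
    isButson_expMatrix (by clear hS; revert k; decide +kernel)
  refine ⟨_, hB, hS, ?_⟩
  have h := hadEquiv_or_transpose_of_minorCount_eq (isButson_reps (Sum.inl k)) hB
    (by rw [minorCount_reps, minorCount_symCode])
  rwa [hS.eq, or_self] at h

theorem mainTheorem1 :
    -- up to equivalence there are exactly 15 matrices BH(4,8)
    Nat.card (Quotient (butsonSetoid 4 8)) = 15 ∧
    -- the listed matrices are BH(4,8), and each class contains exactly one of them
    (∀ k, IsButson 4 (reps k)) ∧
    (∀ H : Matrix (Fin 8) (Fin 8) ℂ, IsButson 4 H → ∃! k, HadEquiv H (reps k)) ∧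
    -- five of them are equivalent to a symmetric BH(4,8) matrix
    (∀ k : Fin 5, ∃ S : Matrix (Fin 8) (Fin 8) ℂ,
      IsButson 4 S ∧ S.IsSymm ∧ HadEquiv (symReps k) S) ∧
    -- the other ten are equivalent neither to their transposes nor to any symmetric matrix
    (∀ k : Fin 5, ¬ HadEquiv (asymReps k) (asymReps k)ᵀ ∧
      ¬ HadEquiv (asymReps k)ᵀ (asymReps k) ∧
      ∀ S : Matrix (Fin 8) (Fin 8) ℂ, S.IsSymm →
        ¬ HadEquiv (asymReps k) S ∧ ¬ HadEquiv (asymReps k)ᵀ S) ∧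
    -- the fingerprint determines a BH(4,8) matrix up to equivalence and transposition
    (∀ H K : Matrix (Fin 8) (Fin 8) ℂ, IsButson 4 H → IsButson 4 K →
      (fingerprint H = fingerprint K ↔ HadEquiv H K ∨ HadEquiv H Kᵀ)) := by
  refine ⟨card_quotient_butsonSetoid, isButson_reps, fun H hH => hH.existsUnique_hadEquiv_reps,
    exists_isSymm_hadEquiv_symReps, fun k => ⟨not_hadEquiv_transpose_asymReps k,
      fun h => not_hadEquiv_transpose_asymReps k h.symm, fun S hS => ⟨fun h => ?_, fun h => ?_⟩⟩,
    fun H K hH hK => fingerprint_eq_iff hH hK⟩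
  -- A matrix equivalent to a symmetric `S` is equivalent to its own transpose, through `S = Sᵀ`.
  · exact not_hadEquiv_transpose_asymReps k (h.trans (hS.eq ▸ h.transpose.symm))
  · have h' := h.transpose
    rw [hS.eq, transpose_transpose] at h'
    exact not_hadEquiv_transpose_asymReps k (h'.trans h.symm)
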